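/- Let $\mathscr{A}(\mathbb{R})$ be the space of complex-valued real analytic functions on $\mathbb{R}$ with its locally convex inductive limit topology $\mathrm{ind}_{\mathbb{R}\subset U} H(U)$, where $U$ runs over the open neighbourhoods of $\mathbb{R}$ in $\mathbb{C}$ and $H(U)$, the space of holomorphic functions on $U$, has the compact-open topology. A continuous linear operator $M$ on $\mathscr{A}(\mathbb{R})$ is a multiplier with multiplier sequence $(m_n)_{n\ge 0}$, $m_n\in\mathbb{C}$, if $M(x^n)=m_n x^n$ for all $n\geq 0$. A family $(T_t)_{t\ge 0}$ of continuous linear operators is a $C_0$-semigroup if $T_tT_s=T_{t+s}$, $T_0=I$ and $\lim_{t\to s}T_tf=T_sf$ for all $t,s\geq 0$ and all $f$. Its generator is $Af=\lim_{t\searrow 0}\frac{T_tf-f}{t}$, defined for exactly those $f$ for which this limit exists. An everywhere defined operator $M$ generates $(T_t)$ if $A$ is everywhere defined and equals $M$. Let $M$ be a multiplier on $\mathscr{A}(\mathbb{R})$ with multiplier sequence $(m_n)_{n\ge 0}$. For every family $(T_t)_{t\geq 0}$ of continuous linear operators on $\mathscr{A}(\mathbb{R})$ the following assertions are equivalent: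 (i) $(T_t)_{t\ge 0}$ is a $C_0$-semigroup generated by $M$. (ii) For every $t\geq 0$ the operator $T_t$ is a multiplier with multiplier sequence $(\exp(tm_n))_{n\ge 0}$, and the map $[0,\infty)\to\mathscr{A}(\mathbb{R})$, $t\mapsto T_tf$, is continuous for every $f\in\mathscr{A}(\mathbb{R})$. (iii) For every $t\geq 0$ the operator $T_t$ is a multiplier with multiplier sequence $(\exp(tm_n))_{n\ge 0}$, and the set $\{T_tf : t\in[0,t_0]\}$ is bounded in $\mathscr{A}(\mathbb{R})$ for every $f\in\mathscr{A}(\mathbb{R})$ and every $t_0\geq 0$. Also equivalent are: the existence of a family $(T_t)_{t\ge 0}$ satisfying (i) (that is, $M$ generates a $C_0$-semigroup), the existence of one satisfying (ii), and the existence of one satisfying (iii). -/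

import Mathlib

open Filter Topology TopologicalSpace
open scoped NNReal

noncomputable section

/-! ### Strongly continuous semigroups on topological vector spaces -/

section Semigroups

variable {X : Type*} [AddCommGroup X] [Module ℂ X] [TopologicalSpace X]

/-- A `C₀`-semigroup `(T_t)_{t ≥ 0}` of continuous linear operators on `X`. -/
structure IsC0Semigroup (T : ℝ≥0 → X →L[ℂ] X) : Prop where
  comp_eq : ∀ t s : ℝ≥0, (T t).comp (T s) = T (t + s)
  zero_eq : T 0 = ContinuousLinearMap.id ℂ X
  tendsto : ∀ (s : ℝ≥0) (x : X), Tendsto (fun t : ℝ≥0 => T t x) (𝓝 s) (𝓝 (T s x))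

/-- `y = lim_{t ↘ 0} (T_t x - x) / t`. -/
def HasDerivAtZero (T : ℝ≥0 → X →L[ℂ] X) (x y : X) : Prop :=
  Tendsto (fun t : ℝ≥0 => ((t : ℝ) : ℂ)⁻¹ • (T t x - x)) (𝓝[>] 0) (𝓝 y)

/-- The partially defined operator `A` is the generator of `T`: a vector `x` lies in the domain
of `A` and `A x = y` if and only if `(T_t x - x) / t` converges to `y` as `t ↘ 0`. -/
def IsGenerator (A : X →ₗ.[ℂ] X) (T : ℝ≥0 → X →L[ℂ] X) : Prop :=
  ∀ x y : X, (x, y) ∈ A.graph ↔ HasDerivAtZero T x y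

/-- The everywhere defined continuous operator `M` generates the `C₀`-semigroup `T`:
the generator of `T` has domain `X` and equals `M`. -/
def GeneratesC0Semigroup (M : X →L[ℂ] X) (T : ℝ≥0 → X →L[ℂ] X) : Prop :=
  IsC0Semigroup T ∧ IsGenerator ((M : X →ₗ[ℂ] X).toPMap ⊤) T

end Semigroups

/-! ### The space of real analytic functions -/

/-- The space `H(U)` of holomorphic functions on an open set `U ⊆ ℂ`, as a subspace of `C(U, ℂ)`;
as such it carries the compact-open topology. -/
def Holo (U : Opens ℂ) : Submodule ℂ C(U, ℂ) where
  carrier := {g | ∃ F : ℂ → ℂ, DifferentiableOn ℂ F U ∧ ∀ z : U, g z = F z}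
  zero_mem' := ⟨0, differentiableOn_const 0, fun _ => rfl⟩
  add_mem' := by
    rintro g h ⟨F, hF, hg⟩ ⟨G, hG, hh⟩
    exact ⟨F + G, hF.add hG, fun z => by simp [hg, hh]⟩
  smul_mem' := by
    rintro c g ⟨F, hF, hg⟩
    exact ⟨c • F, hF.const_smul c, fun z => by simp [hg]⟩

/-- Complex-valued real analytic functions on `ℝ`, as a subspace of all functions. -/
def realAnalyticSubmodule : Submodule ℂ (ℝ → ℂ) where
  carrier := {f | AnalyticOnNhd ℝ f Set.univ}
  zero_mem' := fun _ _ => analyticAt_const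
  add_mem' := fun hf hg x hx => (hf x hx).add (hg x hx)
  smul_mem' := fun c f hf x hx => by
    have h : AnalyticAt ℝ (fun y => c * f y) x := analyticAt_const.mul (hf x hx)
    exact h

/-- The space `𝒜(ℝ)` of complex-valued real analytic functions on `ℝ`. It is a separate type, so
that it does not inherit the topology of pointwise convergence. -/
def RealAnalytic : Type := ↥realAnalyticSubmodule

namespace RealAnalytic

instance : AddCommGroup RealAnalytic := inferInstanceAs (AddCommGroup ↥realAnalyticSubmodule)

instance : Module ℂ RealAnalytic := inferInstanceAs (Module ℂ ↥realAnalyticSubmodule)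

/-- The underlying function. -/
def toFun (f : RealAnalytic) : ℝ → ℂ := Subtype.val f

instance : CoeFun RealAnalytic (fun _ => ℝ → ℂ) := ⟨toFun⟩

/-- A real analytic function as an element of `𝒜(ℝ)`. -/
def mk (f : ℝ → ℂ) (hf : AnalyticOnNhd ℝ f Set.univ) : RealAnalytic :=
  (⟨f, hf⟩ : ↥realAnalyticSubmodule)

theorem ext {f g : RealAnalytic} (h : ∀ x, f x = g x) : f = g := Subtype.ext (funext h)

@[simp] theorem mk_apply (f : ℝ → ℂ) (hf : AnalyticOnNhd ℝ f Set.univ) (x : ℝ) :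
    mk f hf x = f x := rfl

@[simp] theorem add_apply (f g : RealAnalytic) (x : ℝ) : (f + g) x = f x + g x := rfl

@[simp] theorem smul_apply (c : ℂ) (f : RealAnalytic) (x : ℝ) : (c • f) x = c * f x := rfl

/-- The monomial `x ^ n`. -/
def monomial (n : ℕ) : RealAnalytic :=
  mk (fun x => (x : ℂ) ^ n) fun x _ => (Complex.ofRealCLM.analyticAt x).pow n

/-- Restriction to `ℝ`, as a linear map `H(U) → 𝒜(ℝ)`, for an open `U ⊆ ℂ` containing `ℝ`. -/
def restrict (U : Opens ℂ) (hU : ∀ x : ℝ, (x : ℂ) ∈ U) : Holo U →ₗ[ℂ] RealAnalytic where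
  toFun g := mk (fun x => g.1 ⟨x, hU x⟩) <| by
    obtain ⟨F, hF, hg⟩ := g.2
    intro x _
    have h : AnalyticAt ℝ F (x : ℂ) := (hF.analyticOnNhd U.isOpen x (hU x)).restrictScalars
    have h2 : AnalyticAt ℝ (fun y : ℝ => F (y : ℂ)) x :=
      AnalyticAt.comp (f := fun y : ℝ => (y : ℂ)) h (Complex.ofRealCLM.analyticAt x)
    simpa only [hg] using h2
  map_add' _ _ := rfl
  map_smul' _ _ := rfl

/-- The inductive limit topology of `𝒜(ℝ) = ind_{ℝ ⊆ U} H(U)` in the category of locally convex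
spaces: the finest locally convex vector space topology for which all the maps `H(U) → 𝒜(ℝ)` are
continuous, written as the infimum (common refinement) of all such topologies. -/
instance indTopology : TopologicalSpace RealAnalytic :=
  sInf {t : TopologicalSpace RealAnalytic |
    (∀ (U : Opens ℂ) (hU : ∀ x : ℝ, (x : ℂ) ∈ U),
      @Continuous (Holo U) RealAnalytic _ t (restrict U hU)) ∧
    @IsTopologicalAddGroup RealAnalytic t _ ∧
    @ContinuousSMul ℂ RealAnalytic _ _ t ∧
    @LocallyConvexSpace ℝ RealAnalytic _ _ _ _ t}

instance : IsTopologicalAddGroup RealAnalytic :=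
  topologicalAddGroup_sInf fun _ h => h.2.1

instance : ContinuousSMul ℂ RealAnalytic :=
  continuousSMul_sInf fun _ h => h.2.2.1

instance : LocallyConvexSpace ℝ RealAnalytic :=
  .sInf fun _ h => h.2.2.2

theorem continuous_restrict (U : Opens ℂ) (hU : ∀ x : ℝ, (x : ℂ) ∈ U) :
    Continuous (restrict U hU) :=
  continuous_sInf_rng.2 fun _ h => h.1 U hU

/-- Point evaluations are continuous. -/
theorem continuous_eval (x : ℝ) : Continuous (fun f : RealAnalytic => f x) := by
  let ev : RealAnalytic →ₗ[ℂ] (ℝ → ℂ) :=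
    { toFun := fun f => f.toFun, map_add' := fun _ _ => rfl, map_smul' := fun _ _ => rfl }
  have h2 : indTopology ≤ TopologicalSpace.induced ev inferInstance := by
    refine sInf_le ⟨fun U hU => ?_, topologicalAddGroup_induced ev, continuousSMul_induced ev,
      LocallyConvexSpace.induced (ev.restrictScalars ℝ)⟩
    refine continuous_induced_rng.2 (continuous_pi fun y => ?_)
    exact (continuous_eval_const (F := C(U, ℂ)) (⟨y, hU y⟩ : U)).comp continuous_subtype_val
  exact (continuous_apply x).comp (continuous_iff_le_induced.2 h2)

instance : T2Space RealAnalytic := by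
  refine ⟨fun f g hfg => ?_⟩
  obtain ⟨x, hx⟩ : ∃ x, f x ≠ g x := by
    by_contra! h
    exact hfg (ext h)
  exact separated_by_continuous (continuous_eval x) hx

end RealAnalytic

/-! ### Multipliers -/

/-- The continuous linear operator `M` on `𝒜(ℝ)` is a multiplier with multiplier sequence `m`:
each monomial `x ^ n` is an eigenvector of `M` with eigenvalue `m n`. -/
def IsMultiplier (M : RealAnalytic →L[ℂ] RealAnalytic) (m : ℕ → ℂ) : Prop :=
  ∀ n : ℕ, M (RealAnalytic.monomial n) = m n • RealAnalytic.monomial n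

end

/-!
If a semigroup is generated by a multiplier, then the orbit of `x ^ n` has right derivative
`m n` times itself; testing against point evaluations, which separate points, gives
`T t (x ^ n) = exp (t * m n) * x ^ n` (`IsMultiplier.of_generatesC0Semigroup`). Continuous orbits
have compact, hence bounded, segments.

The substantial implication is that bounded orbit segments suffice for a semigroup generated by `M`.
It rests on two properties of `𝒜(ℝ)`.

* It is barrelled: `H(U)` is a Fréchet space, and a seminorm on the inductive limit is continuous
  once its pullbacks to all `H(U)` are (`RealAnalytic.continuous_seminorm_of_comp_restrict`).
* The polynomials are dense (`RealAnalytic.dense_span_monomial`). A real analytic function extends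
  to a holomorphic function `F` on a neighbourhood of `ℝ` that may be taken star-shaped about `0`.
  For a compact subset `K` of it, the map `r ↦ F (r ·)` into `C(K)` modulo the closure of the
  polynomials is analytic near `[0, 1]` and vanishes near `0`, where the Taylor series converges;
  by the identity theorem it vanishes at `r = 1`. This replaces Runge's theorem.

On a barrelled space, `p (T t x)` for `t ≤ t₀` is dominated by a single continuous seminorm of `x`
(`exists_continuous_seminorm_bound`). The semigroup law and strong continuity then pass from the
monomials, where they are explicit, to all of `𝒜(ℝ)`. So does the mean value inequality
`p (T t x - x - t • M x) ≤ t * sup_{s ≤ t} p (T s (M x) - M x)`, proved on polynomials with the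
Hahn-Banach theorem; letting `t` tend to `0`, it shows that the generator is everywhere defined and
equal to `M` (`generatesC0Semigroup_of_dense_span_eigenvectors`).
-/

/-! ### Orbits of semigroups and barrelled spaces -/

section AbstractSemigroups

variable {X : Type*} [AddCommGroup X] [Module ℂ X] [TopologicalSpace X]

theorem mem_graph_toPMap_top_iff (M : X →L[ℂ] X) (x y : X) :
    (x, y) ∈ ((M : X →ₗ[ℂ] X).toPMap ⊤).graph ↔ M x = y := by
  rw [LinearPMap.mem_graph_iff]
  constructor
  · rintro ⟨z, hz, hzy⟩
    exact (congrArg M hz.symm).trans hzy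
  · intro h
    exact ⟨⟨x, trivial⟩, rfl, h⟩

/-- The right derivative of an orbit of a semigroup at `s` is the image under `T s` of its right
derivative at `0`, tested against a continuous functional. -/
theorem hasDerivWithinAt_apply_of_hasDerivAtZero {T : ℝ≥0 → X →L[ℂ] X}
    (hT : ∀ t s : ℝ≥0, (T t).comp (T s) = T (t + s)) {x y : X} (h : HasDerivAtZero T x y)
    (φ : X →L[ℂ] ℂ) (s : ℝ) (hs : 0 ≤ s) :
    HasDerivWithinAt (fun r : ℝ => φ (T r.toNNReal x)) (φ (T s.toNNReal y)) (Set.Ici s) s := by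
  rw [← hasDerivWithinAt_Ioi_iff_Ici, hasDerivWithinAt_iff_tendsto_slope' (by simp)]
  have h1 : Tendsto (fun r : ℝ => (r - s).toNNReal) (𝓝[>] s) (𝓝[>] 0) := by
    refine tendsto_nhdsWithin_iff.2 ⟨?_, ?_⟩
    · have : Continuous (fun r : ℝ => (r - s).toNNReal) := by fun_prop
      simpa using (this.tendsto s).mono_left nhdsWithin_le_nhds
    · filter_upwards [self_mem_nhdsWithin] with r hr
      simpa using hr
  have h2 := (((φ.comp (T s.toNNReal)).continuous.tendsto y).comp h).comp h1
  refine h2.congr' ?_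
  filter_upwards [self_mem_nhdsWithin] with r hr
  have hr' : 0 ≤ r - s := sub_nonneg.2 (le_of_lt hr)
  have e : T s.toNNReal (T (r - s).toNNReal x) = T r.toNNReal x := by
    rw [← ContinuousLinearMap.comp_apply, hT, ← Real.toNNReal_add hs hr', add_sub_cancel]
  simp only [Function.comp_apply, ContinuousLinearMap.comp_apply, map_smul, map_sub, e,
    Real.coe_toNNReal _ hr', slope, vsub_eq_sub, Complex.real_smul, smul_eq_mul, Complex.ofReal_inv,
    Complex.ofReal_sub]

/-- A generator acts on eigenvectors by exponentials, tested against a continuous functional. -/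
theorem apply_eq_exp_of_hasDerivAtZero_smul {T : ℝ≥0 → X →L[ℂ] X} (hT : IsC0Semigroup T)
    {x : X} {c : ℂ} (h : HasDerivAtZero T x (c • x)) (φ : X →L[ℂ] ℂ) (t : ℝ≥0) :
    φ (T t x) = Complex.exp (((t : ℝ) : ℂ) * c) * φ x := by
  have hcont : Continuous (fun t : ℝ≥0 => T t x) :=
    continuous_iff_continuousAt.2 fun s => hT.tendsto s x
  -- `exp (-s c) φ (T s x)` has right derivative zero, so it is constant
  have key := constant_of_has_deriv_right_zero (a := 0) (b := t)
    (f := fun r : ℝ => Complex.exp (-((r : ℂ) * c)) * φ (T r.toNNReal x)) (by fun_prop)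
    (fun s hs => by
      have h1 := hasDerivWithinAt_apply_of_hasDerivAtZero hT.comp_eq h φ s hs.1
      have h2 : HasDerivAt (fun r : ℝ => Complex.exp (-((r : ℂ) * c)))
          (Complex.exp (-((s : ℂ) * c)) * -(1 * c)) s :=
        (((hasDerivAt_id s).ofReal_comp.mul_const c).neg).cexp
      have h3 := h2.hasDerivWithinAt.mul h1
      refine h3.congr_deriv ?_
      simp only [map_smul, smul_eq_mul]
      ring) t ⟨t.2, le_rfl⟩
  simp only [Real.toNNReal_coe, Complex.ofReal_zero, zero_mul, neg_zero, Complex.exp_zero, one_mul,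
    Real.toNNReal_zero, hT.zero_eq, ContinuousLinearMap.id_apply] at key
  rw [← key, ← mul_assoc, ← Complex.exp_add]
  simp

/-- Orbits with bounded segments are dominated by one continuous seminorm: the supremum
of `p ∘ T t` over a bounded interval of times is lower semicontinuous, hence continuous on a
barrelled space. -/
theorem exists_continuous_seminorm_bound [BarrelledSpace ℂ X] {T : ℝ≥0 → X →L[ℂ] X} {t₀ : ℝ≥0}
    (hT : ∀ x, Bornology.IsVonNBounded ℂ ((fun t : ℝ≥0 => T t x) '' Set.Icc 0 t₀))
    {p : Seminorm ℂ X} (hp : Continuous p) :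
    ∃ q : Seminorm ℂ X, Continuous q ∧ ∀ t ≤ t₀, ∀ x, p (T t x) ≤ q x := by
  let P : Set.Icc 0 t₀ → Seminorm ℂ X := fun t => p.comp (T t : X →ₗ[ℂ] X)
  have hb : BddAbove (Set.range P) := by
    rw [Seminorm.bddAbove_range_iff]
    intro x
    have hball : p.ball 0 1 ∈ 𝓝 (0 : X) := by
      rw [p.ball_zero_eq]
      exact (isOpen_lt hp continuous_const).mem_nhds (by simp)
    obtain ⟨r, hr, hr'⟩ := (hT x hball).exists_pos
    refine ⟨r, ?_⟩
    rintro _ ⟨t, rfl⟩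
    have h1 := hr' (r : ℂ) (by simp [abs_of_pos hr]) ⟨t, t.2, rfl⟩
    rw [Seminorm.smul_ball_zero (by simpa using hr.ne'), Seminorm.mem_ball_zero] at h1
    have h2 : p (T t x) < r := by simpa [abs_of_pos hr] using h1
    exact h2.le
  refine ⟨⨆ t, P t, ?_, fun t ht x => ?_⟩
  · rw [Seminorm.coe_iSup_eq hb]
    exact Seminorm.continuous_iSup P (fun i => hp.comp (T i).continuous) hb
  · exact le_ciSup hb (⟨t, zero_le, ht⟩ : Set.Icc 0 t₀) x

end AbstractSemigroups

/-! ### Semigroups with a total set of eigenvectors -/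

section DenseEigenvectors

variable {X ι : Type*} [AddCommGroup X] [Module ℂ X] [TopologicalSpace X]

variable {T : ℝ≥0 → X →L[ℂ] X} {M : X →L[ℂ] X} {e : ι → X} {m : ι → ℂ}

theorem continuous_orbit_of_mem_span_eigenvectors [ContinuousSMul ℂ X] [ContinuousAdd X]
    (hT : ∀ t i, T t (e i) = Complex.exp (((t : ℝ) : ℂ) * m i) • e i)
    {y : X} (hy : y ∈ Submodule.span ℂ (Set.range e)) : Continuous fun t => T t y := by
  induction hy using Submodule.span_induction with
  | mem x hx =>
    obtain ⟨i, rfl⟩ := hx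
    simp only [hT]
    fun_prop
  | zero => simpa using continuous_const
  | add x y _ _ hx hy => simpa using! hx.add hy
  | smul c x _ hx => simpa using! hx.const_smul c

theorem hasDerivWithinAt_orbit_of_mem_span_eigenvectors
    (hM : ∀ i, M (e i) = m i • e i)
    (hT : ∀ t i, T t (e i) = Complex.exp (((t : ℝ) : ℂ) * m i) • e i)
    (φ : X →L[ℂ] ℂ) {y : X} (hy : y ∈ Submodule.span ℂ (Set.range e)) (s : ℝ) (hs : 0 ≤ s) :
    HasDerivWithinAt (fun r : ℝ => φ (T r.toNNReal y)) (φ (T s.toNNReal (M y))) (Set.Ici s) s := by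
  induction hy using Submodule.span_induction with
  | mem x hx =>
    obtain ⟨i, rfl⟩ := hx
    have h : HasDerivAt (fun r : ℝ => Complex.exp ((r : ℂ) * m i))
        (Complex.exp ((s : ℂ) * m i) * (1 * m i)) s :=
      ((hasDerivAt_id s).ofReal_comp.mul_const (m i)).cexp
    refine ((h.mul_const (φ (e i))).hasDerivWithinAt.congr (fun r hr => ?_) ?_).congr_deriv ?_
    · simp [hT, Real.coe_toNNReal r (hs.trans hr)]
    · simp [hT, Real.coe_toNNReal s hs]
    · simp only [hM, map_smul, hT, Real.coe_toNNReal s hs, smul_eq_mul]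
      ring
  | zero => simpa using hasDerivWithinAt_const s (Set.Ici s) (0 : ℂ)
  | add x y _ _ hx hy => simpa using! hx.add hy
  | smul c x _ hx => simpa using! hx.const_mul c

variable [IsTopologicalAddGroup X] [ContinuousSMul ℂ X] [LocallyConvexSpace ℝ X]

open scoped ComplexOrder in
/-- A complex space whose topology has bases of real-convex neighbourhoods is generated by
complex seminorms. -/
theorem polynormableSpace_of_locallyConvexSpace_real : PolynormableSpace ℂ X := by
  have : LocallyConvexSpace ℂ X := by
    refine (locallyConvexSpace_iff_exists_convex_subset ℂ X).2 fun x U hU => ?_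
    obtain ⟨S, hS, hSc, hSU⟩ := (locallyConvexSpace_iff_exists_convex_subset ℝ X).1 ‹_› x U hU
    exact ⟨S, hS, convex_of_nonneg_surjective_algebraMap _
      (fun _ h => RCLike.nonneg_iff_exists_ofReal.mp h) hSc, hSU⟩
  have : ContinuousSMul ℝ X := IsScalarTower.continuousSMul ℂ
  exact LocallyConvexSpace.toPolynormableSpace

theorem tendsto_iff_eventually_seminorm_sub_lt {α : Type*} {l : Filter α} {u : α → X} {y : X} :
    Tendsto u l (𝓝 y) ↔
      ∀ p : Seminorm ℂ X, Continuous p → ∀ ε > 0, ∀ᶠ a in l, p (u a - y) < ε := by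
  have := polynormableSpace_of_locallyConvexSpace_real (X := X)
  rw [(PolynormableSpace.withSeminorms ℂ X).tendsto_nhds u y]
  simp

/-- Mean value inequality for the orbit of a combination of eigenvectors. By the Hahn-Banach
theorem it suffices to test against continuous functionals. -/
theorem seminorm_orbit_sub_le_of_mem_span_eigenvectors
    (hM : ∀ i, M (e i) = m i • e i)
    (hT : ∀ t i, T t (e i) = Complex.exp (((t : ℝ) : ℂ) * m i) • e i)
    {y : X} (hy : y ∈ Submodule.span ℂ (Set.range e)) {p : Seminorm ℂ X} (hp : Continuous p)
    {t : ℝ≥0} {C : ℝ} (hC : ∀ s ≤ t, p (T s (M y) - M y) ≤ C) :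
    p (T t y - y - ((t : ℝ) : ℂ) • M y) ≤ (t : ℝ) * C := by
  by_contra hcon
  have hconv : Convex ℝ (p.closedBall 0 ((t : ℝ) * C)) := p.convex_closedBall _ _
  have hclosed : IsClosed (p.closedBall 0 ((t : ℝ) * C)) := by
    rw [p.closedBall_zero_eq]
    exact isClosed_le hp continuous_const
  obtain ⟨φ, u, hφ, hu⟩ := RCLike.geometric_hahn_banach_closed_point (𝕜 := ℂ) hconv hclosed
    (x := T t y - y - ((t : ℝ) : ℂ) • M y) (by simpa [p.closedBall_zero_eq] using hcon)
  have hT0 : T 0 y = y := by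
    have : Set.EqOn (T 0) (ContinuousLinearMap.id ℂ X) (Submodule.span ℂ (Set.range e)) := by
      refine LinearMap.eqOn_span (f := (T 0 : X →ₗ[ℂ] X)) (g := LinearMap.id) ?_
      rintro _ ⟨i, rfl⟩
      simp [hT]
    exact this hy
  have ht : 0 < (t : ℝ) := by
    rcases eq_or_lt_of_le t.2 with h | h
    · have h0 : t = 0 := NNReal.coe_injective h.symm
      subst h0
      simp [hT0] at hcon
    · exact h
  have hcont : Continuous fun r : ℝ => T r.toNNReal y :=
    (continuous_orbit_of_mem_span_eigenvectors hT hy).comp (by fun_prop)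
  -- `re φ (T r y - y - r M y)` has right derivative `re φ (T r (M y) - M y) ≤ u / t`
  have key := image_le_of_deriv_right_le_deriv_boundary (a := 0) (b := (t : ℝ))
    (f := fun r : ℝ => (φ (T r.toNNReal y) - φ y - (r : ℂ) * φ (M y)).re)
    (f' := fun r : ℝ => (φ (T r.toNNReal (M y)) - 1 * φ (M y)).re)
    (B := fun r => u / t * r) (B' := fun _ => u / t)
    (Complex.continuous_re.comp (((φ.continuous.comp hcont).sub continuous_const).sub
      (Complex.continuous_ofReal.mul continuous_const))).continuousOn
    (fun s hs => by
      have h1 := hasDerivWithinAt_orbit_of_mem_span_eigenvectors hM hT φ hy s hs.1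
      have h2 : HasDerivWithinAt (fun r : ℝ => (r : ℂ) * φ (M y)) (1 * φ (M y)) (Set.Ici s) s :=
        ((hasDerivAt_id s).ofReal_comp.mul_const _).hasDerivWithinAt
      exact Complex.reCLM.hasFDerivAt.comp_hasDerivWithinAt s ((h1.sub_const (φ y)).sub h2))
    (by simp [hT0]) (by fun_prop)
    (fun s _ => by simpa using ((hasDerivAt_id s).const_mul (u / t)).hasDerivWithinAt)
    (fun s hs => by
      have hst : s.toNNReal ≤ t := Real.toNNReal_le_iff_le_coe.2 hs.2.le
      have h1 := hφ (((t : ℝ) : ℂ) • (T s.toNNReal (M y) - M y)) (by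
        rw [p.closedBall_zero_eq, Set.mem_ofPred_eq, map_smul_eq_mul]
        simpa using mul_le_mul_of_nonneg_left (hC _ hst) t.2)
      rw [le_div_iff₀ ht, mul_comm, one_mul]
      simpa using h1.le) (Set.right_mem_Icc.2 t.2)
  rw [div_mul_cancel₀ _ ht.ne'] at key
  refine absurd hu (not_lt.2 ?_)
  simpa using key

/-- A family of operators acting by exponentials on a total set of eigenvectors of `M`, with
bounded orbit segments, is a `C₀`-semigroup generated by `M`. -/
theorem generatesC0Semigroup_of_dense_span_eigenvectors [T2Space X] [BarrelledSpace ℂ X]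
    (hd : Dense (Submodule.span ℂ (Set.range e) : Set X))
    (hM : ∀ i, M (e i) = m i • e i)
    (hT : ∀ t i, T t (e i) = Complex.exp (((t : ℝ) : ℂ) * m i) • e i)
    (hb : ∀ x t₀, Bornology.IsVonNBounded ℂ ((fun t : ℝ≥0 => T t x) '' Set.Icc 0 t₀)) :
    GeneratesC0Semigroup M T := by
  have approx : ∀ (q : Seminorm ℂ X) (_ : Continuous q) (x : X) (ε : ℝ) (_ : 0 < ε),
      ∃ y ∈ Submodule.span ℂ (Set.range e), q (x - y) < ε := fun q hq x ε hε =>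
    hd.exists_mem_open (U := {y | q (x - y) < ε}) (isOpen_lt (by fun_prop) continuous_const)
      ⟨x, by simpa using hε⟩
  have hcont : ∀ s x, Tendsto (fun t : ℝ≥0 => T t x) (𝓝 s) (𝓝 (T s x)) := by
    intro s x
    refine tendsto_iff_eventually_seminorm_sub_lt.2 fun p hp ε hε => ?_
    obtain ⟨q, hq, hpq⟩ := exists_continuous_seminorm_bound (fun x => hb x (s + 1)) hp
    obtain ⟨y, hy, hxy⟩ := approx q hq x (ε / 3) (by positivity)
    have h1 := tendsto_iff_eventually_seminorm_sub_lt.1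
      ((continuous_orbit_of_mem_span_eigenvectors hT hy).tendsto s) p hp (ε / 3) (by positivity)
    have h2 : ∀ᶠ t in 𝓝 s, t < s + 1 := eventually_lt_nhds (lt_add_one s)
    filter_upwards [h1, h2] with t h1 h2
    have e1 : T t x - T s x = T t (x - y) + (T t y - T s y) - T s (x - y) := by
      simp only [map_sub]; abel
    have h3 := hpq t h2.le (x - y)
    have h4 := hpq s (lt_add_one s).le (x - y)
    calc p (T t x - T s x) ≤ p (T t (x - y)) + p (T t y - T s y) + p (T s (x - y)) := by
          rw [e1]
          exact (map_sub_le_add p _ _).trans (by gcongr; exact map_add_le_add p _ _)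
      _ < ε := by linarith
  have hzero : T 0 = ContinuousLinearMap.id ℂ X := by
    refine ContinuousLinearMap.ext_on hd ?_
    rintro _ ⟨i, rfl⟩
    simp [hT]
  -- the mean value inequality extends to all vectors by equicontinuity
  have hmv : ∀ (p : Seminorm ℂ X) (_ : Continuous p) (x : X) (t : ℝ≥0) (C : ℝ),
      (∀ s ≤ t, p (T s (M x) - M x) ≤ C) →
      p (T t x - x - ((t : ℝ) : ℂ) • M x) ≤ (t : ℝ) * C := by
    intro p hp x t C hC
    obtain ⟨q, hq, hpq⟩ := exists_continuous_seminorm_bound (fun x => hb x t) hp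
    refine le_of_forall_pos_le_add fun ε hε => ?_
    let r : Seminorm ℂ X := q + p + (q + p + p).comp (M : X →ₗ[ℂ] X)
    obtain ⟨y, hy, hxy⟩ := approx r
      ((hq.add hp).add (((hq.add hp).add hp).comp M.continuous)) x (ε / (1 + t)) (by positivity)
    have hr : r (x - y) = q (x - y) + p (x - y) +
      (q (M (x - y)) + p (M (x - y)) + p (M (x - y))) := rfl
    rw [hr] at hxy
    have hδ : (1 + t) * (q (x - y) + p (x - y) + (q (M (x - y)) + p (M (x - y)) + p (M (x - y))))
      ≤ ε := by
      rw [lt_div_iff₀ (by positivity)] at hxy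
      linarith
    have n1 := apply_nonneg q (x - y)
    have n2 := apply_nonneg p (x - y)
    have n3 := apply_nonneg q (M (x - y))
    have n4 := apply_nonneg p (M (x - y))
    have h1 := seminorm_orbit_sub_le_of_mem_span_eigenvectors hM hT hy hp (t := t)
      (C := C + (q (M (x - y)) + p (M (x - y)))) (fun s hs => by
        have e1 : T s (M y) - M y = T s (M x) - M x - (T s (M (x - y)) - M (x - y)) := by
          simp only [map_sub]; abel
        calc p (T s (M y) - M y) ≤
              p (T s (M x) - M x) + (p (T s (M (x - y))) + p (M (x - y))) := by
              rw [e1]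
              exact (map_sub_le_add p _ _).trans (by gcongr; exact map_sub_le_add p _ _)
          _ ≤ _ := by gcongr; exacts [hC s hs, hpq s hs _])
    have e2 : T t x - x - ((t : ℝ) : ℂ) • M x = (T t y - y - ((t : ℝ) : ℂ) • M y) +
        (T t (x - y) - (x - y) - ((t : ℝ) : ℂ) • M (x - y)) := by
      simp only [map_sub, smul_sub]; abel
    have h2 : p (T t (x - y) - (x - y) - ((t : ℝ) : ℂ) • M (x - y)) ≤
        q (x - y) + p (x - y) + t * p (M (x - y)) := by
      refine (map_sub_le_add p _ _).trans ?_
      rw [map_smul_eq_mul]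
      simp only [Complex.norm_real, Real.norm_eq_abs, NNReal.abs_eq]
      gcongr
      exact (map_sub_le_add p _ _).trans (by gcongr; exact hpq t le_rfl _)
    rw [e2]
    refine (map_add_le_add p _ _).trans ?_
    nlinarith [mul_nonneg t.2 n1, mul_nonneg t.2 n2, mul_nonneg t.2 n3, mul_nonneg t.2 n4]
  have hderiv : ∀ x, HasDerivAtZero T x (M x) := by
    intro x
    refine tendsto_iff_eventually_seminorm_sub_lt.2 fun p hp ε hε => ?_
    have h0 := hcont 0 (M x)
    rw [hzero, ContinuousLinearMap.id_apply] at h0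
    have h1 := tendsto_iff_eventually_seminorm_sub_lt.1 h0 p hp (ε / 2) (by positivity)
    obtain ⟨δ, hδ, hδ'⟩ := (nhds_bot_basis (α := ℝ≥0)).eventually_iff.1 h1
    have h2 : ∀ᶠ t : ℝ≥0 in 𝓝[>] 0, t < δ := nhdsWithin_le_nhds (eventually_lt_nhds hδ)
    filter_upwards [h2, self_mem_nhdsWithin] with t ht ht0
    have ht0' : 0 < (t : ℝ) := ht0
    have h3 := hmv p hp x t (ε / 2) fun s hs => (hδ' (hs.trans_lt ht)).le
    have e1 : ((t : ℝ) : ℂ)⁻¹ • (T t x - x) - M x =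
        ((t : ℝ) : ℂ)⁻¹ • (T t x - x - ((t : ℝ) : ℂ) • M x) := by
      rw [smul_sub _ (T t x - x), inv_smul_smul₀ (by exact_mod_cast ht0'.ne')]
    rw [e1, map_smul_eq_mul, norm_inv, Complex.norm_real, Real.norm_eq_abs, NNReal.abs_eq,
      inv_mul_lt_iff₀ ht0']
    exact h3.trans_lt (by gcongr; linarith)
  refine ⟨⟨fun t s => ?_, hzero, hcont⟩, fun x y => ?_⟩
  · refine ContinuousLinearMap.ext_on hd ?_
    rintro _ ⟨i, rfl⟩
    simp [hT, smul_smul, ← Complex.exp_add, add_mul, add_comm]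
  · rw [mem_graph_toPMap_top_iff]
    exact ⟨fun h => h ▸ hderiv x, fun h => tendsto_nhds_unique (hderiv x) h⟩

end DenseEigenvectors

/-! ### The spaces `H(U)` and `𝒜(ℝ)` are barrelled -/

section HolomorphicFunctions

theorem mem_Holo_iff_differentiableOn_extend {U : Opens ℂ} {g : C(U, ℂ)} :
    g ∈ Holo U ↔ DifferentiableOn ℂ (Function.extend Subtype.val g 0) U := by
  have hext : ∀ z : U, Function.extend Subtype.val g 0 (z : ℂ) = g z := fun z =>
    Subtype.val_injective.extend_apply g 0 z
  constructor
  · rintro ⟨F, hF, hg⟩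
    exact hF.congr fun z hz => (hext ⟨z, hz⟩).trans (hg ⟨z, hz⟩)
  · exact fun h => ⟨_, h, fun z => (hext z).symm⟩

theorem isClosed_Holo (U : Opens ℂ) : IsClosed (Holo U : Set C(U, ℂ)) := by
  have : LocallyCompactSpace U := U.isOpen.locallyCompactSpace
  refine isClosed_of_closure_subset fun g hg => ?_
  have : (𝓝[(Holo U : Set C(U, ℂ))] g).NeBot := mem_closure_iff_nhdsWithin_neBot.1 hg
  have h1 : Tendsto (fun h : C(U, ℂ) => h) (𝓝[(Holo U : Set C(U, ℂ))] g) (𝓝 g) :=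
    nhdsWithin_le_nhds
  rw [ContinuousMap.tendsto_iff_tendstoLocallyUniformly] at h1
  have h2 : TendstoLocallyUniformlyOn
      (fun (h : C(U, ℂ)) (z : ℂ) => Function.extend Subtype.val h 0 z)
      (Function.extend Subtype.val g 0) (𝓝[(Holo U : Set C(U, ℂ))] g) U := by
    rw [tendstoLocallyUniformlyOn_iff_tendstoLocallyUniformly_comp_coe]
    convert! h1 using 1
    · ext h z
      exact Subtype.val_injective.extend_apply h 0 z
    · ext z
      exact Subtype.val_injective.extend_apply g 0 z
  refine mem_Holo_iff_differentiableOn_extend.2 (h2.differentiableOn ?_ U.isOpen)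
  filter_upwards [self_mem_nhdsWithin] with h hh
  exact mem_Holo_iff_differentiableOn_extend.1 hh

/-- `H(U)` is a Fréchet space, hence a Baire space, hence barrelled. -/
instance barrelledSpace_Holo (U : Opens ℂ) : BarrelledSpace ℂ (Holo U) := by
  have : LocallyCompactSpace U := U.isOpen.locallyCompactSpace
  have : CompleteSpace (Holo U) := (isClosed_Holo U).completeSpace_coe
  have : (uniformity (Holo U)).IsCountablyGenerated := Filter.comap.isCountablyGenerated _ _
  infer_instance

/-- A holomorphic function as an element of `H(U)`. -/
noncomputable def Holo.mk {U : Opens ℂ} (F : ℂ → ℂ) (hF : DifferentiableOn ℂ F U) : Holo U :=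
  ⟨⟨fun z => F z, continuousOn_iff_continuous_domRestrict.1 hF.continuousOn⟩, F, hF, fun _ => rfl⟩

end HolomorphicFunctions

/-- The seminormed topology of `p` is a locally convex vector space topology for which `p` is
continuous, and a linear map `f` into it is continuous as soon as `p ∘ f` is. -/
theorem exists_locallyConvex_topology_of_seminorm {X : Type*} [AddCommGroup X] [Module ℂ X]
    (p : Seminorm ℂ X) :
    ∃ t : TopologicalSpace X, @Continuous X ℝ t _ p ∧ @IsTopologicalAddGroup X t _ ∧
      @ContinuousSMul ℂ X _ _ t ∧ @LocallyConvexSpace ℝ X _ _ _ _ t ∧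
      ∀ {Y : Type} [AddCommGroup Y] [Module ℂ Y] [TopologicalSpace Y] [IsTopologicalAddGroup Y]
        (f : Y →ₗ[ℂ] X), Continuous (fun y => p (f y)) → @Continuous Y X _ t f := by
  let P : SeminormFamily ℂ X Unit := fun _ => p
  let t : TopologicalSpace X := P.moduleFilterBasis.topology
  have hP : WithSeminorms P := ⟨rfl⟩
  have := hP.topologicalAddGroup
  refine ⟨t, hP.continuous_seminorm (), this, hP.continuousSMul, hP.toLocallyConvexSpace, ?_⟩
  intro Y _ _ _ _ f hf
  exact hP.continuous_of_continuous_comp f fun _ => hf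

namespace RealAnalytic

/-- The universal property of the inductive limit topology, for seminorms. -/
theorem continuous_seminorm_of_comp_restrict (p : Seminorm ℂ RealAnalytic)
    (hp : ∀ (U : Opens ℂ) (hU : ∀ x : ℝ, (x : ℂ) ∈ U), Continuous fun g => p (restrict U hU g)) :
    Continuous p := by
  obtain ⟨t, h1, h2, h3, h4, h5⟩ := exists_locallyConvex_topology_of_seminorm p
  have hle : indTopology ≤ t := by
    refine sInf_le ⟨fun U hU => ?_, h2, h3, h4⟩
    exact h5 (Y := Holo U) (restrict U hU) (hp U hU)
  exact @Continuous.comp _ _ _ indTopology t _ id p h1 (continuous_id_iff_le.2 hle)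

instance : BarrelledSpace ℂ RealAnalytic where
  continuous_of_lowerSemicontinuous p hp := by
    refine continuous_seminorm_of_comp_restrict p fun U hU => ?_
    let q : Seminorm ℂ (Holo U) := p.comp (restrict U hU)
    have hq : LowerSemicontinuous q :=
      LowerSemicontinuous.comp (g := restrict U hU) hp (continuous_restrict U hU)
    exact Seminorm.continuous_of_lowerSemicontinuous q hq

end RealAnalytic

/-! ### Polynomial approximation on star-shaped domains -/

section PolynomialApproximation

/-- The dilation `z ↦ F (r z)` as a continuous function on `K`, for those `r` for which this
function is continuous on `K`; the value is `0` for all other `r`. -/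
noncomputable def dilation (F : ℂ → ℂ) (K : Set ℂ) (r : ℂ) : C(K, ℂ) :=
  open Classical in
  if h : Continuous fun z : K => F (r * z) then ⟨_, h⟩ else 0

theorem dilation_apply {F : ℂ → ℂ} {U K : Set ℂ} {r : ℂ} (hF : ContinuousOn F U)
    (hr : ∀ z ∈ K, r * z ∈ U) (z : K) : dilation F K r z = F (r * z) := by
  have h : Continuous fun z : K => F (r * z) :=
    hF.comp_continuous (by fun_prop) fun z => hr z z.2
  simp [dilation, h]

theorem eventually_forall_mul_mem {U K : Set ℂ} (hU : IsOpen U) (hK : IsCompact K) {r : ℂ}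
    (hr : ∀ z ∈ K, r * z ∈ U) : ∀ᶠ s in 𝓝 r, ∀ z ∈ K, s * z ∈ U :=
  hK.eventually_forall_of_forall_eventually fun z hz =>
    (continuous_mul.tendsto (r, z)).eventually (hU.mem_nhds (hr z hz))

/-- On a compact set the dilations of a holomorphic function depend holomorphically on the dilation
factor, in the supremum norm. -/
theorem differentiableAt_dilation {F : ℂ → ℂ} {U K : Set ℂ} (hU : IsOpen U)
    (hF : DifferentiableOn ℂ F U) (hK : IsCompact K) {r : ℂ} (hr : ∀ z ∈ K, r * z ∈ U) :
    DifferentiableAt ℂ (dilation F K) r := by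
  have : CompactSpace K := isCompact_iff_compactSpace.1 hK
  have hF' : ContinuousOn (deriv F) U := (hF.deriv hU).continuousOn
  have hcont : Continuous fun z : K => (z : ℂ) * deriv F (r * z) :=
    continuous_subtype_val.mul (hF'.comp_continuous (by fun_prop) fun z => hr z z.2)
  let G' : C(K, ℂ) := ⟨_, hcont⟩
  refine HasDerivAt.differentiableAt (f' := G') ?_
  rw [hasDerivAt_iff_isLittleO, Asymptotics.isLittleO_iff]
  intro ε hε
  have h1 : ∀ᶠ s in 𝓝 r, ∀ z ∈ K, ‖z * deriv F (s * z) - z * deriv F (r * z)‖ < ε := by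
    refine hK.eventually_forall_of_forall_eventually fun z hz => ?_
    have c1 : ContinuousAt (fun q : ℂ × ℂ => deriv F (q.1 * q.2)) (r, z) :=
      ContinuousAt.comp (f := fun q : ℂ × ℂ => q.1 * q.2)
        (hF'.continuousAt (hU.mem_nhds (hr z hz))) (by fun_prop)
    have c2 : ContinuousAt (fun q : ℂ × ℂ => deriv F (r * q.2)) (r, z) :=
      ContinuousAt.comp (f := fun q : ℂ × ℂ => r * q.2)
        (hF'.continuousAt (hU.mem_nhds (hr z hz))) (by fun_prop)
    have c3 : ContinuousAt
        (fun q : ℂ × ℂ => ‖q.2 * deriv F (q.1 * q.2) - q.2 * deriv F (r * q.2)‖) (r, z) := by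
      fun_prop
    exact c3.eventually (eventually_lt_nhds (by simpa using hε))
  obtain ⟨δ, hδ, hball⟩ := Metric.eventually_nhds_iff_ball.1
    (h1.and (eventually_forall_mul_mem hU hK hr))
  filter_upwards [Metric.ball_mem_nhds r hδ] with s hs
  refine (ContinuousMap.norm_le _ (by positivity)).2 fun z => ?_
  have hz := z.2
  -- mean value inequality for `s ↦ F (s z) - s z F' (r z)` on the disc of radius `δ` about `r`
  have h2 := (convex_ball r δ).norm_image_sub_le_of_norm_hasDerivWithin_le (C := ε) (x := r) (y := s)
    (f := fun s => F (s * z) - s * (z * deriv F (r * z)))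
    (f' := fun s => z * deriv F (s * z) - z * deriv F (r * z))
    (fun w hw => by
      have hd : HasDerivAt F (deriv F (w * z)) (w * z) :=
        (hF.differentiableAt (hU.mem_nhds ((hball w hw).2 z hz))).hasDerivAt
      have h3 : HasDerivAt (fun s : ℂ => s * (z : ℂ)) z w := by
        simpa using (hasDerivAt_id w).mul_const (z : ℂ)
      have h4 : HasDerivAt (fun s : ℂ => s * (z * deriv F (r * z))) (z * deriv F (r * z)) w := by
        simpa using (hasDerivAt_id w).mul_const (z * deriv F (r * z))
      refine (((hd.comp w h3).sub h4).congr_deriv ?_).hasDerivWithinAt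
      ring)
    (fun w hw => ((hball w hw).1 z hz).le) (Metric.mem_ball_self hδ) hs
  have e1 := dilation_apply hF.continuousOn (hball s hs).2 z
  have e2 := dilation_apply hF.continuousOn hr z
  simp only [ContinuousMap.sub_apply, ContinuousMap.smul_apply, e1, e2, smul_eq_mul]
  convert! h2 using 2
  simp only [G', ContinuousMap.coe_mk]
  ring

/-- A small dilation of a function holomorphic near `0` is a uniform limit of polynomials: of its
Taylor polynomials. -/
theorem eventually_dilation_mem_closure_polynomialFunctions {F : ℂ → ℂ} {U K : Set ℂ}
    (hU : IsOpen U) (hF : DifferentiableOn ℂ F U) (h0 : (0 : ℂ) ∈ U) (hK : IsCompact K) :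
    ∀ᶠ r in 𝓝 (0 : ℂ), dilation F K r ∈
      (Subalgebra.toSubmodule (polynomialFunctions K)).topologicalClosure := by
  have : CompactSpace K := isCompact_iff_compactSpace.1 hK
  obtain ⟨R, hR, hRU⟩ := Metric.nhds_basis_closedBall.mem_iff.1 (hU.mem_nhds h0)
  lift R to ℝ≥0 using hR.le
  have hR' : 0 < R := by exact_mod_cast hR
  have hp := (hF.mono hRU).hasFPowerSeriesOnBall hR'
  have hunif := hp.tendstoUniformlyOn (r' := R / 2) (by exact_mod_cast NNReal.half_lt_self hR'.ne')
  set p := cauchyPowerSeries F 0 R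
  have hball : (0 : ℂ) ∈ Metric.ball (0 : ℂ) (R / 2 : ℝ≥0) :=
    Metric.mem_ball_self (by exact_mod_cast half_pos hR')
  filter_upwards [eventually_forall_mul_mem Metric.isOpen_ball hK (r := 0)
    (fun z _ => by rw [zero_mul]; exact hball)] with r hr
  let Q : ℕ → Polynomial ℂ := fun n =>
    ∑ k ∈ Finset.range n, Polynomial.C (p.coeff k * r ^ k) * Polynomial.X ^ k
  have hQ : ∀ n z, (Q n).eval z = p.partialSum n (r * z) := by
    intro n z
    simp only [Q, Polynomial.eval_finsetSum, FormalMultilinearSeries.partialSum,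
      FormalMultilinearSeries.apply_eq_pow_smul_coeff, Polynomial.eval_mul, Polynomial.eval_C,
      Polynomial.eval_pow, Polynomial.eval_X, smul_eq_mul]
    exact Finset.sum_congr rfl fun k _ => by ring
  have hrU : ∀ z ∈ K, r * z ∈ U := fun z hz => hRU (Metric.closedBall_subset_closedBall
    (by exact_mod_cast (half_le_self R.2)) (Metric.ball_subset_closedBall (hr z hz)))
  have hlim : Tendsto (fun n => (Q n).toContinuousMapOn K) atTop (𝓝 (dilation F K r)) := by
    rw [ContinuousMap.tendsto_iff_tendstoUniformly, Metric.tendstoUniformly_iff]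
    intro ε hε
    filter_upwards [Metric.tendstoUniformlyOn_iff.1 hunif ε hε] with n hn z
    rw [dilation_apply hF.continuousOn hrU z]
    simpa [hQ] using hn (r * z) (hr z z.2)
  refine mem_closure_of_tendsto hlim (Eventually.of_forall fun n => ?_)
  exact (polynomialFunctions_coe K).symm ▸ ⟨Q n, rfl⟩

/-- Polynomial approximation on compact subsets of a domain that is star-shaped about `0`. The
class of the dilation `F (r ·)` modulo the closed span of the polynomials is analytic in `r` near
`[0, 1]` and vanishes near `0`, hence also at `r = 1`. -/
theorem exists_polynomial_norm_sub_lt_of_starConvex {F : ℂ → ℂ} {U K : Set ℂ} (hU : IsOpen U)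
    (hstar : StarConvex ℝ 0 U) (h0 : (0 : ℂ) ∈ U) (hF : DifferentiableOn ℂ F U) (hK : IsCompact K)
    (hKU : K ⊆ U) {ε : ℝ} (hε : 0 < ε) :
    ∃ P : Polynomial ℂ, ∀ z ∈ K, ‖F z - P.eval z‖ < ε := by
  have : CompactSpace K := isCompact_iff_compactSpace.1 hK
  set V := (Subalgebra.toSubmodule (polynomialFunctions K)).topologicalClosure
  have : IsClosed (V : Set C(K, ℂ)) := Submodule.isClosed_topologicalClosure _
  let Ω : Set ℂ := {r | ∀ z ∈ K, r * z ∈ U}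
  have hΩ : IsOpen Ω := isOpen_iff_mem_nhds.2 fun r hr => eventually_forall_mul_mem hU hK hr
  let H : ℂ → C(K, ℂ) ⧸ V := fun r => V.mkQ (dilation F K r)
  have hH : AnalyticOnNhd ℂ H Ω := by
    refine DifferentiableOn.analyticOnNhd (fun r hr => DifferentiableAt.differentiableWithinAt ?_) hΩ
    exact V.mkQL.differentiableAt.comp r (differentiableAt_dilation hU hF hK hr)
  have hseg : segment ℝ (0 : ℂ) 1 ⊆ Ω := by
    intro r hr z hz
    rw [segment_eq_image] at hr
    obtain ⟨θ, hθ, rfl⟩ := hr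
    have := hstar.smul_mem (hKU hz) hθ.1 hθ.2
    simpa using this
  have hzero : H =ᶠ[𝓝 0] 0 := by
    filter_upwards [eventually_dilation_mem_closure_polynomialFunctions hU hF h0 hK] with r hr
    exact (Submodule.Quotient.mk_eq_zero V).2 hr
  have hH1 : H 1 = 0 := (hH.mono hseg).eqOn_zero_of_preconnected_of_eventuallyEq_zero
    (convex_segment (𝕜 := ℝ) (0 : ℂ) 1).isPreconnected (left_mem_segment ℝ 0 1) hzero
    (right_mem_segment ℝ 0 1)
  have hmem : dilation F K 1 ∈ closure (polynomialFunctions K : Set C(K, ℂ)) :=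
    (Submodule.Quotient.mk_eq_zero V).1 hH1
  obtain ⟨q, hq, hlt⟩ := Metric.mem_closure_iff.1 hmem ε hε
  rw [polynomialFunctions_coe] at hq
  obtain ⟨P, rfl⟩ := hq
  refine ⟨P, fun z hz => ?_⟩
  have h1 := ((dist_eq_norm (dilation F K 1) _) ▸ ContinuousMap.norm_coe_le_norm
    (dilation F K 1 - Polynomial.toContinuousMapOnAlgHom K P) ⟨z, hz⟩).trans_lt hlt
  have e1 := dilation_apply (r := 1) hF.continuousOn (fun z hz => by simpa using hKU hz) ⟨z, hz⟩
  simpa [e1] using h1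

end PolynomialApproximation

/-! ### Holomorphic extension and density of the polynomials -/

section HolomorphicExtension

/-- The power series of a real analytic function, read with a complex variable, extends the
function holomorphically to a complex disc. -/
theorem exists_differentiableOn_ball_eq_of_analyticAt {f : ℝ → ℂ} {x : ℝ}
    (hf : AnalyticAt ℝ f x) :
    ∃ r > 0, ∃ F : ℂ → ℂ, DifferentiableOn ℂ F (Metric.ball (x : ℂ) r) ∧
      ∀ y : ℝ, (y : ℂ) ∈ Metric.ball (x : ℂ) r → F y = f y := by
  obtain ⟨p, R, hp⟩ := hf
  let q : FormalMultilinearSeries ℂ ℂ ℂ := .ofScalars ℂ p.coeff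
  have hq : ∀ n, q.coeff n = p.coeff n := fun n =>
    FormalMultilinearSeries.coeff_ofScalars
  have hrad : q.radius = p.radius := by
    have hn : ∀ n, ‖q n‖ = ‖p n‖ := fun n => by
      rw [FormalMultilinearSeries.norm_apply_eq_norm_coef,
        FormalMultilinearSeries.norm_apply_eq_norm_coef, hq]
    simp only [FormalMultilinearSeries.radius, hn]
  have hRq : R ≤ q.radius := hrad ▸ hp.r_le
  obtain ⟨r, hr0, hrR⟩ := ENNReal.lt_iff_exists_nnreal_btwn.1 hp.r_pos
  have hr0' : (0 : ℝ) < r := by exact_mod_cast hr0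
  have hq' := (q.hasFPowerSeriesOnBall (hp.r_pos.trans_le hRq)).mono hr0 (hrR.le.trans hRq)
  refine ⟨r, hr0', fun z => q.sum (z - x), ?_, fun y hy => ?_⟩
  · have h1 : DifferentiableOn ℂ q.sum (Metric.ball 0 r) := by
      have := hq'.differentiableOn
      rwa [Metric.eball_coe] at this
    exact h1.comp (by fun_prop) fun z hz => by simpa [dist_eq_norm] using hz
  · have hyx : ‖y - x‖ < r := by
      rw [mem_ball_iff_norm, ← Complex.ofReal_sub, Complex.norm_real] at hy
      exact hy
    have h1 := hp.hasSum (y := y - x) (by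
      rw [Metric.mem_eball, edist_zero_right]
      refine lt_of_lt_of_le ?_ hrR.le
      rw [enorm_eq_nnnorm]
      exact_mod_cast hyx)
    rw [add_sub_cancel] at h1
    rw [← h1.tsum_eq]
    change ∑' n, q n (fun _ => (y : ℂ) - x) = _
    refine tsum_congr fun n => ?_
    rw [FormalMultilinearSeries.apply_eq_pow_smul_coeff,
      FormalMultilinearSeries.apply_eq_pow_smul_coeff, hq, ← Complex.ofReal_sub,
      ← Complex.ofReal_pow, Complex.coe_smul]

/-- Holomorphic extensions of the same function to two discs centred on the real line agree on the
intersection of the discs: it is convex and, unless empty, meets the real line in an interval. -/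
theorem eqOn_inter_ball_of_eq_real {f : ℝ → ℂ} {x y r s : ℝ} {F G : ℂ → ℂ}
    (hF : DifferentiableOn ℂ F (Metric.ball (x : ℂ) r))
    (hG : DifferentiableOn ℂ G (Metric.ball (y : ℂ) s))
    (hFf : ∀ u : ℝ, (u : ℂ) ∈ Metric.ball (x : ℂ) r → F u = f u)
    (hGf : ∀ u : ℝ, (u : ℂ) ∈ Metric.ball (y : ℂ) s → G u = f u) :
    Set.EqOn F G (Metric.ball (x : ℂ) r ∩ Metric.ball (y : ℂ) s) := by
  intro z hz
  set B := Metric.ball (x : ℂ) r ∩ Metric.ball (y : ℂ) s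
  have hB : IsOpen B := Metric.isOpen_ball.inter Metric.isOpen_ball
  -- the real part of a point in a disc centred on the real line lies in the disc
  have hre : ∀ (a ρ : ℝ), z ∈ Metric.ball (a : ℂ) ρ → (z.re : ℂ) ∈ Metric.ball (a : ℂ) ρ := by
    intro a ρ h
    rw [mem_ball_iff_norm] at h ⊢
    refine lt_of_le_of_lt ?_ h
    have := Complex.abs_re_le_norm (z - a)
    rwa [← Complex.ofReal_sub, Complex.norm_real]
  have hzB : (z.re : ℂ) ∈ B := ⟨hre x r hz.1, hre y s hz.2⟩
  have hconv : Convex ℝ B := (convex_ball _ _).inter (convex_ball _ _)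
  refine ((hF.mono Set.inter_subset_left).analyticOnNhd hB).eqOn_of_preconnected_of_frequently_eq
    ((hG.mono Set.inter_subset_right).analyticOnNhd hB) hconv.isPreconnected hzB ?_ hz
  have hev : ∀ᶠ u : ℝ in 𝓝[≠] z.re, F u = G u := by
    refine nhdsWithin_le_nhds ?_
    filter_upwards [Complex.continuous_ofReal.continuousAt.preimage_mem_nhds (hB.mem_nhds hzB)]
      with u hu
    rw [hFf u hu.1, hGf u hu.2]
  refine Tendsto.frequently (f := fun u : ℝ => (u : ℂ)) ?_ hev.frequently
  refine tendsto_nhdsWithin_iff.2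
    ⟨(Complex.continuous_ofReal.tendsto _).mono_left nhdsWithin_le_nhds, ?_⟩
  filter_upwards [self_mem_nhdsWithin] with u hu
  simpa using hu

/-- A real analytic function extends holomorphically to a neighbourhood of the real line. -/
theorem exists_differentiableOn_eq_of_analyticOnNhd {f : ℝ → ℂ}
    (hf : AnalyticOnNhd ℝ f Set.univ) :
    ∃ (U : Set ℂ) (F : ℂ → ℂ), IsOpen U ∧ (∀ x : ℝ, (x : ℂ) ∈ U) ∧ DifferentiableOn ℂ F U ∧
      ∀ x : ℝ, F x = f x := by
  choose r hr F hF hFf using fun x => exists_differentiableOn_ball_eq_of_analyticAt (hf x trivial)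
  -- glue the local extensions, choosing at each point one of the discs that contain it
  let G : ℂ → ℂ := fun z =>
    open Classical in if h : ∃ x : ℝ, z ∈ Metric.ball (x : ℂ) (r x) then F h.choose z else 0
  have hG : ∀ x : ℝ, Set.EqOn G (F x) (Metric.ball (x : ℂ) (r x)) := by
    intro x z hz
    have h : ∃ x : ℝ, z ∈ Metric.ball (x : ℂ) (r x) := ⟨x, hz⟩
    simp only [G, dif_pos h]
    exact eqOn_inter_ball_of_eq_real (hF _) (hF x) (hFf _) (hFf x) ⟨h.choose_spec, hz⟩
  refine ⟨⋃ x : ℝ, Metric.ball (x : ℂ) (r x), G, isOpen_iUnion fun _ => Metric.isOpen_ball,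
    fun x => Set.mem_iUnion.2 ⟨x, Metric.mem_ball_self (hr x)⟩, ?_, fun x => ?_⟩
  · intro z hz
    obtain ⟨x, hx⟩ := Set.mem_iUnion.1 hz
    exact (((hF x).congr (hG x)).differentiableAt
      (Metric.isOpen_ball.mem_nhds hx)).differentiableWithinAt
  · rw [hG x (Metric.mem_ball_self (hr x)), hFf x x (Metric.mem_ball_self (hr x))]

/-- Every open neighbourhood of the real line contains an open neighbourhood of the real line that
is star-shaped about `0`. -/
theorem exists_starConvex_open_subset {U : Set ℂ} (hU : IsOpen U) (hR : ∀ x : ℝ, (x : ℂ) ∈ U) :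
    ∃ W ⊆ U, IsOpen W ∧ (∀ x : ℝ, (x : ℂ) ∈ W) ∧ StarConvex ℝ 0 W := by
  refine ⟨{z | ∀ θ ∈ Set.Icc (0 : ℝ) 1, (θ : ℂ) * z ∈ U}, fun z hz => ?_, ?_, fun x θ _ => ?_, ?_⟩
  · simpa using hz 1 ⟨zero_le_one, le_rfl⟩
  · refine isOpen_iff_mem_nhds.2 fun z hz => ?_
    refine isCompact_Icc.eventually_forall_of_forall_eventually fun θ hθ => ?_
    have hc : Continuous fun q : ℂ × ℝ => (q.2 : ℂ) * q.1 := by fun_prop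
    exact (hc.tendsto (z, θ)).eventually (hU.mem_nhds (hz θ hθ))
  · simpa using hR (θ * x)
  · refine starConvex_zero_iff.2 fun z hz a ha0 ha1 θ hθ => ?_
    have := hz (θ * a) ⟨mul_nonneg hθ.1 ha0, mul_le_one₀ hθ.2 ha0 ha1⟩
    simpa [mul_assoc] using this

end HolomorphicExtension

namespace RealAnalytic

theorem restrict_mk_polynomial_mem_span (U : Opens ℂ) (hU : ∀ x : ℝ, (x : ℂ) ∈ U)
    (P : Polynomial ℂ) :
    restrict U hU (Holo.mk (fun z => P.eval z) P.differentiable.differentiableOn) ∈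
      Submodule.span ℂ (Set.range monomial) := by
  have h : restrict U hU (Holo.mk (fun z => P.eval z) P.differentiable.differentiableOn) =
      ∑ k ∈ Finset.range (P.natDegree + 1), P.coeff k • monomial k := by
    refine ext fun x => ?_
    have hsum : ∀ s : Finset ℕ, (∑ k ∈ s, P.coeff k • monomial k : RealAnalytic) x =
        ∑ k ∈ s, P.coeff k * (x : ℂ) ^ k := by
      intro s
      induction s using Finset.induction_on with
      | empty => rfl
      | insert a s ha ih =>
        rw [Finset.sum_insert ha, Finset.sum_insert ha, add_apply, ih]
        rfl
    rw [hsum]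
    exact Polynomial.eval_eq_sum_range (x : ℂ)
  rw [h]
  exact Submodule.sum_mem _ fun k _ => Submodule.smul_mem _ _ (Submodule.subset_span ⟨k, rfl⟩)

/-- The polynomials are dense in `𝒜(ℝ)`: every real analytic function extends holomorphically to a
domain `W` star-shaped about `0`, and there it is a limit of polynomials in `H(W)`. -/
theorem dense_span_monomial :
    Dense (Submodule.span ℂ (Set.range monomial) : Set RealAnalytic) := by
  intro f
  obtain ⟨U, F, hUo, hUR, hF, hFf⟩ := exists_differentiableOn_eq_of_analyticOnNhd f.2
  obtain ⟨W, hWU, hWo, hWR, hW⟩ := exists_starConvex_open_subset hUo hUR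
  let V : Opens ℂ := ⟨W, hWo⟩
  have hFV : DifferentiableOn ℂ F V := hF.mono hWU
  have hf : f = restrict V hWR (Holo.mk F hFV) := ext fun x => (hFf x).symm
  rw [hf]
  refine map_mem_closure (continuous_restrict V hWR) (s := {g | ∃ P : Polynomial ℂ,
    g = Holo.mk (fun z => P.eval z) P.differentiable.differentiableOn}) ?_ ?_
  · rw [closure_subtype]
    refine (mem_closure_iff_nhds_basis (nhds_basis_uniformity'
      Metric.uniformity_basis_dist.compactConvergenceUniformity)).2 ?_
    rintro ⟨K, ε⟩ ⟨hK, hε⟩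
    obtain ⟨P, hP⟩ := exists_polynomial_norm_sub_lt_of_starConvex hWo hW
      (by simpa using hWR 0) hFV (hK.image continuous_subtype_val)
      (by rintro _ ⟨z, _, rfl⟩; exact z.2) hε
    refine ⟨_, ⟨_, ⟨P, rfl⟩, rfl⟩, fun z hz => ?_⟩
    change dist (F z) (P.eval (z : ℂ)) < ε
    rw [dist_eq_norm]
    exact hP z ⟨z, hz, rfl⟩
  · rintro _ ⟨P, rfl⟩
    exact restrict_mk_polynomial_mem_span V hWR P

end RealAnalytic

/-! ### Semigroups of multipliers -/

namespace RealAnalytic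

/-- Point evaluation as a continuous functional. -/
noncomputable def evalCLM (x : ℝ) : RealAnalytic →L[ℂ] ℂ where
  toFun f := f x
  map_add' _ _ := rfl
  map_smul' _ _ := rfl
  cont := continuous_eval x

end RealAnalytic

/-- The operators of a semigroup generated by a multiplier are multipliers: tested against point
evaluations, the orbit of `x ^ n` solves `u' = m n * u`. -/
theorem IsMultiplier.of_generatesC0Semigroup {M : RealAnalytic →L[ℂ] RealAnalytic} {m : ℕ → ℂ}
    (hM : IsMultiplier M m) {T : ℝ≥0 → RealAnalytic →L[ℂ] RealAnalytic}
    (hT : GeneratesC0Semigroup M T) (t : ℝ≥0) :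
    IsMultiplier (T t) fun n => Complex.exp (((t : ℝ) : ℂ) * m n) := by
  intro n
  refine RealAnalytic.ext fun x => ?_
  have h : HasDerivAtZero T (RealAnalytic.monomial n) (m n • RealAnalytic.monomial n) :=
    (hT.2 _ _).1 ((mem_graph_toPMap_top_iff M _ _).2 (hM n))
  exact apply_eq_exp_of_hasDerivAtZero_smul hT.1 h (RealAnalytic.evalCLM x) t

theorem mainTheorem1 (M : RealAnalytic →L[ℂ] RealAnalytic) (m : ℕ → ℂ) (hM : IsMultiplier M m) :
    (∀ T : ℝ≥0 → RealAnalytic →L[ℂ] RealAnalytic,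
      List.TFAE [
        GeneratesC0Semigroup M T,
        (∀ t : ℝ≥0, IsMultiplier (T t) (fun n => Complex.exp (((t : ℝ) : ℂ) * m n))) ∧
          ∀ f : RealAnalytic, Continuous (fun t : ℝ≥0 => T t f),
        (∀ t : ℝ≥0, IsMultiplier (T t) (fun n => Complex.exp (((t : ℝ) : ℂ) * m n))) ∧
          ∀ (f : RealAnalytic) (t₀ : ℝ≥0),
            Bornology.IsVonNBounded ℂ ((fun t : ℝ≥0 => T t f) '' Set.Icc 0 t₀)]) ∧
    List.TFAE [
      ∃ T : ℝ≥0 → RealAnalytic →L[ℂ] RealAnalytic, GeneratesC0Semigroup M T,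
      ∃ T : ℝ≥0 → RealAnalytic →L[ℂ] RealAnalytic,
        (∀ t : ℝ≥0, IsMultiplier (T t) (fun n => Complex.exp (((t : ℝ) : ℂ) * m n))) ∧
          ∀ f : RealAnalytic, Continuous (fun t : ℝ≥0 => T t f),
      ∃ T : ℝ≥0 → RealAnalytic →L[ℂ] RealAnalytic,
        (∀ t : ℝ≥0, IsMultiplier (T t) (fun n => Complex.exp (((t : ℝ) : ℂ) * m n))) ∧
          ∀ (f : RealAnalytic) (t₀ : ℝ≥0),
            Bornology.IsVonNBounded ℂ ((fun t : ℝ≥0 => T t f) '' Set.Icc 0 t₀)] := by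
  have key : ∀ T : ℝ≥0 → RealAnalytic →L[ℂ] RealAnalytic,
      List.TFAE [
        GeneratesC0Semigroup M T,
        (∀ t : ℝ≥0, IsMultiplier (T t) (fun n => Complex.exp (((t : ℝ) : ℂ) * m n))) ∧
          ∀ f : RealAnalytic, Continuous (fun t : ℝ≥0 => T t f),
        (∀ t : ℝ≥0, IsMultiplier (T t) (fun n => Complex.exp (((t : ℝ) : ℂ) * m n))) ∧
          ∀ (f : RealAnalytic) (t₀ : ℝ≥0),
            Bornology.IsVonNBounded ℂ ((fun t : ℝ≥0 => T t f) '' Set.Icc 0 t₀)] := by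
    intro T
    tfae_have 1 → 2 := fun h =>
      ⟨hM.of_generatesC0Semigroup h, fun f => continuous_iff_continuousAt.2 fun s => h.1.tendsto s f⟩
    tfae_have 2 → 3 := fun h => ⟨h.1, fun f _ => (isCompact_Icc.image (h.2 f)).isVonNBounded ℂ⟩
    tfae_have 3 → 1 := fun h =>
      generatesC0Semigroup_of_dense_span_eigenvectors RealAnalytic.dense_span_monomial hM h.1 h.2
    tfae_finish
  refine ⟨key, ?_⟩
  tfae_have 1 ↔ 2 := exists_congr fun T => (key T).out 0 1
  tfae_have 2 ↔ 3 := exists_congr fun T => (key T).out 1 2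
  tfae_finish
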